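/- Let $\mathcal S$ be the class of functions $f$ that are analytic and injective (univalent) in the open unit disc $\mathbb D=\{z\in\mathbb C:|z|<1\}$ and have there the form $$f(z)=z+a_2z^2+a_3z^3+\cdots .$$ Put $$H_2(2)=a_2a_4-a_3^2,\qquad H_3(1)=a_3(a_2a_4-a_3^2)-a_4(a_4-a_2a_3)+a_5(a_3-a_2^2).$$ If $f\in\mathcal S$ and $a_3=0$, then 1. $|a_2|\le 1$; 2. $|a_4|\le \dfrac{\sqrt{37}+13}{12}$; 3. $|a_5|\le \dfrac14\sqrt{\dfrac{757}{15}}+\dfrac{85}{64}$; 4. $|H_2(2)|\le \dfrac{13+\sqrt{37}}{12}$; 5. $|H_3(1)|\le \dfrac{24+\sqrt{645}}{30}$. -/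

import Mathlib

/-- The class `A` of normalized analytic functions: `f` is analytic on the open unit disc, with
`f 0 = 0` and `f' 0 = 1`, i.e. `f z = z + a₂ z ^ 2 + a₃ z ^ 3 + ⋯` there. Only the values of `f`
on the open unit disc matter. -/
def classA : Set (ℂ → ℂ) :=
  {f | AnalyticOnNhd ℂ f (Metric.ball (0 : ℂ) 1) ∧ f 0 = 0 ∧ deriv f 0 = 1}

/-- The class `S` of those `f` in `A` that are univalent (injective) on the open unit disc. -/
def classS : Set (ℂ → ℂ) :=
  {f | f ∈ classA ∧ Set.InjOn f (Metric.ball (0 : ℂ) 1)}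

/-- The `n`-th Taylor coefficient `a_n = f⁽ⁿ⁾(0) / n!` of `f` at the origin. -/
noncomputable def taylorCoeff (f : ℂ → ℂ) (n : ℕ) : ℂ :=
  iteratedDeriv n f 0 / (n.factorial : ℂ)

/-- The second Hankel determinant `H₂(2) = a₂ a₄ - a₃ ^ 2`. -/
noncomputable def hankelTwoTwo (f : ℂ → ℂ) : ℂ :=
  taylorCoeff f 2 * taylorCoeff f 4 - taylorCoeff f 3 ^ 2

/-- The third Hankel determinant
`H₃(1) = a₃ (a₂ a₄ - a₃ ^ 2) - a₄ (a₄ - a₂ a₃) + a₅ (a₃ - a₂ ^ 2)`. -/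
noncomputable def hankelThreeOne (f : ℂ → ℂ) : ℂ :=
  taylorCoeff f 3 * (taylorCoeff f 2 * taylorCoeff f 4 - taylorCoeff f 3 ^ 2)
    - taylorCoeff f 4 * (taylorCoeff f 4 - taylorCoeff f 2 * taylorCoeff f 3)
    + taylorCoeff f 5 * (taylorCoeff f 3 - taylorCoeff f 2 ^ 2)

/-! Since `f` is injective and vanishes at 0, `1/f = 1/z + b₀ + b₁z + ⋯` is analytic and injective
on the punctured disc, and Gronwall's area theorem gives `∑ k|b_k|² ≤ 1`. When `a₃ = 0`, the first
coefficients are `b₁ = a₂²`, `b₂ = -u`, `b₃ = -v` with `u = a₄ + a₂³` and `v = a₅ - 2a₂a₄ - a₂⁴`, so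
`|a₂|⁴ + 2|u|² + 3|v|² ≤ 1`. All five quantities are polynomials in `a₂, u, v`; for instance `H₃(1)
= -(u² + a₂²v)`. Triangle inequalities and completed squares then suffice, with slack in the last
four bounds.

The area theorem is proved without boundary curves, by estimating the area of the image of `ρ < |z|
< r` twice. From below, it is `∫|F'|²`, handled in polar coordinates with Bessel's inequality on
circles (`ofReal_le_volume_image_annulus`). From above, a real-linear correction places the image in
a disc of area `π/ρ² + O(ρ)` (`exists_volume_image_annulus_le`). The terms `π/ρ²` cancel; then `ρ →
0` and `r → 1`. -/

section AreaTheorem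

open MeasureTheory Metric Set Filter Topology
open scoped Real ENNReal ComplexConjugate

/-! ### Calculus of Taylor coefficients. -/

theorem taylorCoeff_zero (f : ℂ → ℂ) : taylorCoeff f 0 = f 0 := by
  simp [taylorCoeff]

theorem taylorCoeff_one (f : ℂ → ℂ) : taylorCoeff f 1 = deriv f 0 := by
  simp [taylorCoeff]

theorem taylorCoeff_deriv (f : ℂ → ℂ) (n : ℕ) :
    taylorCoeff (deriv f) n = (n + 1) * taylorCoeff f (n + 1) := by
  have h1 : (n.factorial : ℂ) ≠ 0 := by exact_mod_cast n.factorial_ne_zero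
  have h2 : (n + 1 : ℂ) ≠ 0 := by exact_mod_cast n.succ_ne_zero
  simp only [taylorCoeff, iteratedDeriv_succ', Nat.factorial_succ]
  push_cast
  field_simp

theorem taylorCoeff_dslope {f : ℂ → ℂ} (hf : AnalyticAt ℂ f 0) (n : ℕ) :
    taylorCoeff (dslope f 0) n = taylorCoeff f (n + 1) := by
  have key : ∀ {g : ℂ → ℂ} {p : FormalMultilinearSeries ℂ ℂ ℂ}, HasFPowerSeriesAt g p 0 →
      ∀ m, taylorCoeff g m = p.coeff m := by
    intro g p hg m
    have := hg.eq_formalMultilinearSeries hg.analyticAt.hasFPowerSeriesAt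
    rw [this, FormalMultilinearSeries.coeff_ofScalars, taylorCoeff]
  obtain ⟨p, hp⟩ := hf
  rw [key hp, key hp.has_fpower_series_dslope_fslope, FormalMultilinearSeries.coeff_fslope]

theorem taylorCoeff_mul {f g : ℂ → ℂ} (hf : AnalyticAt ℂ f 0) (hg : AnalyticAt ℂ g 0) (n : ℕ) :
    taylorCoeff (f * g) n =
      ∑ i ∈ Finset.range (n + 1), taylorCoeff f i * taylorCoeff g (n - i) := by
  have hn : (n.factorial : ℂ) ≠ 0 := by exact_mod_cast n.factorial_ne_zero
  rw [taylorCoeff, iteratedDeriv_mul hf.contDiffAt hg.contDiffAt, Finset.sum_div]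
  refine Finset.sum_congr rfl fun i hi ↦ ?_
  have hi' : i ≤ n := by simpa [Nat.lt_succ_iff] using hi
  have h1 : (i.factorial : ℂ) ≠ 0 := by exact_mod_cast i.factorial_ne_zero
  have h2 : ((n - i).factorial : ℂ) ≠ 0 := by exact_mod_cast (n - i).factorial_ne_zero
  have h3 : ((n.choose i : ℂ)) * i.factorial * (n - i).factorial = n.factorial := by
    exact_mod_cast Nat.choose_mul_factorial_mul_factorial hi'
  simp only [taylorCoeff]
  rw [div_mul_div_comm, div_eq_div_iff hn (mul_ne_zero h1 h2), ← h3]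
  ring

theorem eq_add_mul_dslope (f : ℂ → ℂ) (z : ℂ) : f z = f 0 + z * dslope f 0 z := by
  have := sub_smul_dslope f 0 z
  simp only [sub_zero, smul_eq_mul] at this
  rw [this]; ring

/-! ### Mean squares on circles. -/

/-- The cross term is twice the real part of an analytic function vanishing at 0, so its mean is
zero. Iterating with `dslope` peels off one Taylor coefficient at a time. -/
theorem circleAverage_norm_sq_const_add_mul {g : ℂ → ℂ} {R s : ℝ}
    (hg : DifferentiableOn ℂ g (ball 0 R)) (hs : 0 ≤ s) (hsR : s < R) (c : ℂ) :
    Real.circleAverage (fun z ↦ ‖c + z * g z‖ ^ 2) 0 s =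
      ‖c‖ ^ 2 + s ^ 2 * Real.circleAverage (fun z ↦ ‖g z‖ ^ 2) 0 s := by
  have hsub : closedBall (0 : ℂ) s ⊆ ball 0 R := closedBall_subset_ball hsR
  have hgc : ContinuousOn g (sphere 0 s) :=
    hg.continuousOn.mono (sphere_subset_closedBall.trans hsub)
  have hG : DifferentiableOn ℂ (fun z ↦ conj c * (z * g z)) (ball 0 R) :=
    (differentiableOn_id.mul hg).const_mul _
  have hGc : ContinuousOn (fun z ↦ conj c * (z * g z)) (sphere 0 s) :=
    hG.continuousOn.mono (sphere_subset_closedBall.trans hsub)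
  have hmean : Real.circleAverage (fun z ↦ conj c * (z * g z)) 0 s = 0 := by
    have : DiffContOnCl ℂ (fun z ↦ conj c * (z * g z)) (ball 0 |s|) := by
      rw [abs_of_nonneg hs]; exact hG.diffContOnCl_ball hsub
    rw [this.circleAverage]; simp
  have hre : Real.circleAverage (fun z ↦ (conj c * (z * g z)).re) 0 s = 0 := by
    have := Complex.reCLM.circleAverage_comp_comm (hGc.circleIntegrable hs)
    rw [hmean] at this
    simpa [Function.comp_def] using this
  have i1 : CircleIntegrable (fun z ↦ s ^ 2 • ‖g z‖ ^ 2) 0 s :=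
    ((hgc.norm.pow 2).const_smul (s ^ 2)).circleIntegrable hs
  have i0 : CircleIntegrable (fun z ↦ ‖c‖ ^ 2 + s ^ 2 • ‖g z‖ ^ 2) 0 s :=
    (circleIntegrable_const _ _ _).add i1
  have i2 : CircleIntegrable (fun z ↦ (2 : ℝ) • (conj c * (z * g z)).re) 0 s :=
    ((Complex.continuous_re.comp_continuousOn hGc).const_smul (2 : ℝ)).circleIntegrable hs
  have hexp : EqOn (fun z ↦ ‖c + z * g z‖ ^ 2)
      (fun z ↦ (‖c‖ ^ 2 + s ^ 2 • ‖g z‖ ^ 2) + (2 : ℝ) • (conj c * (z * g z)).re)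
      (sphere 0 |s|) := by
    intro z hz
    have hz' : ‖z‖ = s := by simpa [abs_of_nonneg hs] using hz
    simp only [smul_eq_mul]
    rw [← hz', ← mul_pow, ← norm_mul]
    simp only [← Complex.normSq_eq_norm_sq, Complex.normSq_apply, Complex.add_re, Complex.add_im,
      Complex.mul_re, Complex.conj_re, Complex.conj_im, Complex.mul_im]
    ring
  rw [Real.circleAverage_congr_sphere hexp,
    Real.circleAverage_fun_add i0 i2,
    Real.circleAverage_fun_add (circleIntegrable_const _ _ _) i1,
    Real.circleAverage_fun_smul, Real.circleAverage_fun_smul, hre, Real.circleAverage_const]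
  simp

/-- Bessel's inequality for the Taylor coefficients on a circle. -/
theorem sum_norm_taylorCoeff_sq_le_circleAverage {g : ℂ → ℂ} {R s : ℝ}
    (hg : DifferentiableOn ℂ g (ball 0 R)) (hs : 0 ≤ s) (hsR : s < R) (N : ℕ) :
    ∑ k ∈ Finset.range N, ‖taylorCoeff g k‖ ^ 2 * s ^ (2 * k) ≤
      Real.circleAverage (fun z ↦ ‖g z‖ ^ 2) 0 s := by
  have h0 : ball (0 : ℂ) R ∈ 𝓝 0 := ball_mem_nhds _ (hs.trans_lt hsR)
  induction N generalizing g with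
  | zero => simpa using Real.circleAverage_nonneg_of_nonneg fun z _ ↦ by positivity
  | succ N ih =>
    have hd : DifferentiableOn ℂ (dslope g 0) (ball 0 R) := (Complex.differentiableOn_dslope h0).2 hg
    have := circleAverage_norm_sq_const_add_mul hd hs hsR (g 0)
    simp only [← eq_add_mul_dslope] at this
    rw [this, Finset.sum_range_succ', add_comm, taylorCoeff_zero]
    simp only [mul_zero, pow_zero, mul_one]
    gcongr
    refine le_trans (le_of_eq ?_) (mul_le_mul_of_nonneg_left (ih hd) (sq_nonneg s))
    rw [Finset.mul_sum]
    refine Finset.sum_congr rfl fun k _ ↦ ?_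
    rw [taylorCoeff_dslope (hg.analyticAt h0)]
    ring

/-! ### Lower bound for the area of the image of an annulus. -/

theorem lintegral_annulus_eq_lintegral_circleMap {u : ℂ → ℝ≥0∞} (hu : Measurable u) {ρ r : ℝ}
    (hρ : 0 ≤ ρ) :
    ∫⁻ z in {z : ℂ | ρ < ‖z‖ ∧ ‖z‖ < r}, u z =
      ∫⁻ s in Ioo ρ r, ENNReal.ofReal s * ∫⁻ θ in Ioo (-π) π, u (circleMap 0 s θ) := by
  have hA : MeasurableSet {z : ℂ | ρ < ‖z‖ ∧ ‖z‖ < r} :=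
    (measurableSet_lt measurable_const measurable_norm).inter
      (measurableSet_lt measurable_norm measurable_const)
  have hc : Measurable fun p : ℝ × ℝ ↦ circleMap 0 p.1 p.2 := by
    unfold circleMap; fun_prop
  have hm : Measurable fun p : ℝ × ℝ ↦ ENNReal.ofReal p.1 * u (circleMap 0 p.1 p.2) :=
    (ENNReal.measurable_ofReal.comp measurable_fst).mul (hu.comp hc)
  rw [← lintegral_indicator hA, ← Complex.lintegral_comp_polarCoord_symm]
  have hsub : Ioo ρ r ×ˢ Ioo (-π) π ⊆ polarCoord.target :=
    prod_mono (fun x hx ↦ hρ.trans_lt hx.1) subset_rfl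
  have hms : MeasurableSet (Ioo ρ r ×ˢ Ioo (-π) π) := measurableSet_Ioo.prod measurableSet_Ioo
  have hmt : MeasurableSet polarCoord.target := polarCoord.open_target.measurableSet
  have key : EqOn (fun p : ℝ × ℝ ↦ ENNReal.ofReal p.1 •
      {z : ℂ | ρ < ‖z‖ ∧ ‖z‖ < r}.indicator u (Complex.polarCoord.symm p))
      ((Ioo ρ r ×ˢ Ioo (-π) π).indicator
        fun p ↦ ENNReal.ofReal p.1 * u (circleMap 0 p.1 p.2)) polarCoord.target := by
    rintro ⟨s, θ⟩ ⟨hs, hθ⟩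
    have hs' : 0 < s := hs
    have e : Complex.polarCoord.symm (s, θ) = circleMap 0 s θ := by
      simp [circleMap, Complex.exp_mul_I]
    simp only [e, smul_eq_mul, indicator_apply, mem_prod, mem_ofPred_eq, norm_circleMap_zero,
      abs_of_pos hs', mem_Ioo]
    by_cases h : ρ < s ∧ s < r <;> simp_all
  rw [setLIntegral_congr_fun hmt key, lintegral_indicator hms, Measure.restrict_restrict hms,
    inter_eq_left.2 hsub, Measure.volume_eq_prod, ← Measure.prod_restrict,
    lintegral_prod _ hm.aemeasurable]
  refine lintegral_congr fun s ↦ ?_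
  have hus : Measurable fun θ ↦ u (circleMap 0 s θ) :=
    hu.comp (hc.comp (measurable_const.prodMk measurable_id))
  exact lintegral_const_mul (ENNReal.ofReal s) hus

theorem lintegral_circleMap_eq_ofReal_circleAverage {g : ℂ → ℝ} {s : ℝ} (hs : 0 ≤ s)
    (hg : ContinuousOn g (sphere 0 s)) (h0 : ∀ z ∈ sphere 0 s, 0 ≤ g z) :
    ∫⁻ θ in Ioo (-π) π, ENNReal.ofReal (g (circleMap 0 s θ)) =
      ENNReal.ofReal (2 * π * Real.circleAverage g 0 s) := by
  have hc : Continuous fun θ ↦ g (circleMap 0 s θ) :=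
    hg.comp_continuous (continuous_circleMap 0 s) fun θ ↦ circleMap_mem_sphere 0 hs θ
  have hper : Function.Periodic (fun θ ↦ g (circleMap 0 s θ)) (2 * π) :=
    (periodic_circleMap 0 s).comp g
  have e : 2 * π * Real.circleAverage g 0 s = ∫ θ in (-π)..π, g (circleMap 0 s θ) := by
    have h := hper.intervalIntegral_add_eq 0 (-π)
    rw [zero_add, show -π + 2 * π = π by ring] at h
    rw [Real.circleAverage_def, h, smul_eq_mul, mul_inv_cancel_left₀ (by positivity)]
  rw [e, intervalIntegral.integral_of_le (by linarith [Real.pi_pos]), integral_Ioc_eq_integral_Ioo,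
    ofReal_integral_eq_lintegral_ofReal]
  · exact (hc.integrableOn_Icc).mono_set Ioo_subset_Icc_self
  · exact Eventually.of_forall fun θ ↦ h0 _ (circleMap_mem_sphere 0 hs θ)

/-- Change of variables: the real Jacobian of a holomorphic map is the squared modulus of its
derivative. -/
theorem volume_image_eq_lintegral_norm_deriv_sq {F : ℂ → ℂ} {s : Set ℂ} (hs : IsOpen s)
    (hF : DifferentiableOn ℂ F s) (hinj : InjOn F s) :
    volume (F '' s) = ∫⁻ z in s, ENNReal.ofReal (‖deriv F z‖ ^ 2) := by
  have h : ∀ z ∈ s, HasFDerivWithinAt F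
      ((ContinuousLinearMap.toSpanSingleton ℂ (deriv F z)).restrictScalars ℝ) s z := fun z hz ↦
    ((hF.differentiableAt (hs.mem_nhds hz)).hasDerivAt.hasFDerivAt.restrictScalars
      ℝ).hasFDerivWithinAt
  rw [← lintegral_abs_det_fderiv_eq_addHaar_image volume hs.measurableSet h hinj]
  refine lintegral_congr fun z ↦ ?_
  congr 1
  simp [ContinuousLinearMap.det, LinearMap.det_restrictScalars, Algebra.norm_complex_eq,
    Complex.normSq_eq_norm_sq]

theorem deriv_inv_add {p : ℂ → ℂ} {z : ℂ} (hz : z ≠ 0) (hp : DifferentiableAt ℂ p z) :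
    deriv (fun z ↦ z⁻¹ + p z) z = (z ^ 2)⁻¹ * (-1 + z * (z * deriv p z)) := by
  rw [((hasDerivAt_inv hz).fun_add hp.hasDerivAt).deriv]
  field_simp

theorem circleAverage_norm_deriv_inv_add_sq_ge {p : ℂ → ℂ} {R s : ℝ}
    (hp : DifferentiableOn ℂ p (ball 0 R)) (hs : 0 < s) (hsR : s < R) (N : ℕ) :
    (s ^ 4)⁻¹ + ∑ k ∈ Finset.range N, (k + 1) ^ 2 * ‖taylorCoeff p (k + 1)‖ ^ 2 * s ^ (2 * k) ≤
      Real.circleAverage (fun z ↦ ‖deriv (fun z ↦ z⁻¹ + p z) z‖ ^ 2) 0 s := by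
  have hd : DifferentiableOn ℂ (deriv p) (ball 0 R) := hp.deriv isOpen_ball
  have hd' : DifferentiableOn ℂ (fun z ↦ z * deriv p z) (ball 0 R) := differentiableOn_id.mul hd
  have e : EqOn (fun z ↦ ‖deriv (fun z ↦ z⁻¹ + p z) z‖ ^ 2)
      (fun z ↦ (s ^ 4)⁻¹ • ‖-1 + z * (z * deriv p z)‖ ^ 2) (sphere 0 |s|) := by
    intro z hz
    have hz' : ‖z‖ = s := by simpa [abs_of_pos hs] using hz
    have hz0 : z ≠ 0 := by rintro rfl; simp at hz'; exact hs.ne hz'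
    have hzR : z ∈ ball (0 : ℂ) R := by simpa [hz'] using hsR
    simp only
    rw [deriv_inv_add hz0 (hp.differentiableAt (isOpen_ball.mem_nhds hzR)), norm_mul, norm_inv,
      norm_pow, hz', mul_pow, inv_pow, ← pow_mul, smul_eq_mul]
  -- The constant 0 extracts the inner factor `z`; the constant `-1` is then split off the outer
  -- expression.
  have h2 := circleAverage_norm_sq_const_add_mul hd hs.le hsR 0
  simp only [zero_add] at h2
  rw [Real.circleAverage_congr_sphere e, Real.circleAverage_fun_smul,
    circleAverage_norm_sq_const_add_mul hd' hs.le hsR, h2]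
  have hB := sum_norm_taylorCoeff_sq_le_circleAverage hd hs.le hsR N
  have hB' : ∑ k ∈ Finset.range N, (k + 1) ^ 2 * ‖taylorCoeff p (k + 1)‖ ^ 2 * s ^ (2 * k) =
      ∑ k ∈ Finset.range N, ‖taylorCoeff (deriv p) k‖ ^ 2 * s ^ (2 * k) := by
    refine Finset.sum_congr rfl fun k _ ↦ ?_
    have : ‖(k + 1 : ℂ)‖ = k + 1 := by exact_mod_cast Complex.norm_natCast (k + 1)
    rw [taylorCoeff_deriv, norm_mul, this, mul_pow]
  rw [hB']
  refine (add_le_add_right hB _).trans (le_of_eq ?_)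
  simp only [norm_neg, norm_one, norm_zero, smul_eq_mul]
  field_simp
  ring

theorem ofReal_le_volume_image_annulus {p : ℂ → ℂ} {ρ r : ℝ}
    (hp : DifferentiableOn ℂ p (ball 0 1)) (hρ : 0 < ρ) (hρr : ρ ≤ r) (hr : r < 1)
    (hinj : InjOn (fun z ↦ z⁻¹ + p z) {z : ℂ | ρ < ‖z‖ ∧ ‖z‖ < r}) (N : ℕ) :
    ENNReal.ofReal (π * ((ρ ^ 2)⁻¹ - (r ^ 2)⁻¹ + (∑ k ∈ Finset.range N,
      (k + 1) * ‖taylorCoeff p (k + 1)‖ ^ 2 * r ^ (2 * k + 2) - ∑ k ∈ Finset.range N,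
      (k + 1) * ‖taylorCoeff p (k + 1)‖ ^ 2 * ρ ^ (2 * k + 2)))) ≤
      volume ((fun z ↦ z⁻¹ + p z) '' {z : ℂ | ρ < ‖z‖ ∧ ‖z‖ < r}) := by
  set F : ℂ → ℂ := fun z ↦ z⁻¹ + p z with hFdef
  set A : Set ℂ := {z : ℂ | ρ < ‖z‖ ∧ ‖z‖ < r} with hAdef
  have hA : IsOpen A := (isOpen_lt continuous_const continuous_norm).inter
    (isOpen_lt continuous_norm continuous_const)
  have hFd : DifferentiableOn ℂ F {z : ℂ | 0 < ‖z‖ ∧ ‖z‖ < 1} := by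
    refine DifferentiableOn.add (fun z hz ↦ ?_) (hp.mono fun z hz ↦ by simpa using hz.2)
    exact (differentiableAt_inv (norm_pos_iff.1 hz.1)).differentiableWithinAt
  have hO : IsOpen {z : ℂ | 0 < ‖z‖ ∧ ‖z‖ < 1} :=
    (isOpen_lt continuous_const continuous_norm).inter (isOpen_lt continuous_norm continuous_const)
  have hF'c : ContinuousOn (deriv F) {z : ℂ | 0 < ‖z‖ ∧ ‖z‖ < 1} := (hFd.deriv hO).continuousOn
  set G' : ℝ → ℝ := fun s ↦ 2 * π * (s * ((s ^ 4)⁻¹ +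
    ∑ k ∈ Finset.range N, (k + 1) ^ 2 * ‖taylorCoeff p (k + 1)‖ ^ 2 * s ^ (2 * k))) with hG'
  have hG'c : ContinuousOn G' (Icc ρ r) := by
    have : ContinuousOn (fun s : ℝ ↦ (s ^ 4)⁻¹) (Icc ρ r) :=
      (continuousOn_id.pow 4).inv₀ fun s hs ↦ pow_ne_zero 4 (hρ.trans_le hs.1).ne'
    fun_prop
  have hG'0 : ∀ s ∈ Icc ρ r, 0 ≤ G' s := fun s hs ↦ by
    have : 0 < s := hρ.trans_le hs.1
    positivity
  have hint : ∫ s in ρ..r, G' s = π * ((ρ ^ 2)⁻¹ - (r ^ 2)⁻¹ + (∑ k ∈ Finset.range N,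
      (k + 1) * ‖taylorCoeff p (k + 1)‖ ^ 2 * r ^ (2 * k + 2) - ∑ k ∈ Finset.range N,
      (k + 1) * ‖taylorCoeff p (k + 1)‖ ^ 2 * ρ ^ (2 * k + 2))) := by
    have hder : ∀ s ∈ uIcc ρ r, HasDerivAt (fun s : ℝ ↦ π * (-(s ^ 2)⁻¹ + ∑ k ∈ Finset.range N,
        (k + 1) * ‖taylorCoeff p (k + 1)‖ ^ 2 * s ^ (2 * k + 2))) (G' s) s := by
      intro s hs
      rw [uIcc_of_le hρr] at hs
      have hs0 : s ≠ 0 := (hρ.trans_le hs.1).ne'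
      have h1 := ((hasDerivAt_pow 2 s).inv (pow_ne_zero 2 hs0)).neg
      have h2 := HasDerivAt.fun_sum (u := Finset.range N) fun k _ ↦
        (hasDerivAt_pow (2 * k + 2) s).const_mul
          (((k : ℝ) + 1) * ‖taylorCoeff p (k + 1)‖ ^ 2)
      refine ((h1.add h2).const_mul π).congr_deriv ?_
      simp only [hG', mul_add, Finset.mul_sum]
      congr 1
      · field_simp
        norm_num
        field_simp
      · refine Finset.sum_congr rfl fun k _ ↦ ?_
        rw [show 2 * k + 2 - 1 = 2 * k + 1 by omega]
        push_cast
        ring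
    rw [intervalIntegral.integral_eq_sub_of_hasDerivAt hder
      ((hG'c.mono (uIcc_of_le hρr).le).intervalIntegrable)]
    ring
  rw [volume_image_eq_lintegral_norm_deriv_sq hA
    (hFd.mono fun z hz ↦ ⟨hρ.trans hz.1, hz.2.trans hr⟩) hinj,
    lintegral_annulus_eq_lintegral_circleMap
      (u := fun z ↦ ENNReal.ofReal (‖deriv F z‖ ^ 2))
      ((measurable_deriv F).norm.pow_const 2).ennreal_ofReal hρ.le,
    ← hint, intervalIntegral.integral_of_le hρr, integral_Ioc_eq_integral_Ioo,
    ofReal_integral_eq_lintegral_ofReal (hG'c.integrableOn_Icc.mono_set Ioo_subset_Icc_self)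
      ((ae_restrict_iff' measurableSet_Ioo).2
        (Eventually.of_forall fun s hs ↦ hG'0 s (Ioo_subset_Icc_self hs)))]
  refine setLIntegral_mono' measurableSet_Ioo fun s hs ↦ ?_
  have hs0 : 0 < s := hρ.trans hs.1
  have hsub : sphere (0 : ℂ) s ⊆ {z : ℂ | 0 < ‖z‖ ∧ ‖z‖ < 1} := fun z hz ↦ by
    have : ‖z‖ = s := by simpa using hz
    exact ⟨this ▸ hs0, this ▸ hs.2.trans hr⟩
  rw [lintegral_circleMap_eq_ofReal_circleAverage (g := fun z ↦ ‖deriv F z‖ ^ 2) hs0.le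
    ((hF'c.mono hsub).norm.pow 2) fun z _ ↦ by positivity, ← ENNReal.ofReal_mul hs0.le]
  apply ENNReal.ofReal_le_ofReal
  have := circleAverage_norm_deriv_inv_add_sq_ge hp hs0 (hs.2.trans hr) N
  calc G' s = s * (2 * π * ((s ^ 4)⁻¹ +
        ∑ k ∈ Finset.range N, (k + 1) ^ 2 * ‖taylorCoeff p (k + 1)‖ ^ 2 * s ^ (2 * k))) := by
        simp only [hG']; ring
    _ ≤ _ := by gcongr

/-! ### Upper bound for the area, and the area theorem. -/

/-- The real linear map `w ↦ w - β * conj w`. -/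
noncomputable def subMulConj (β : ℂ) : ℂ →ₗ[ℝ] ℂ :=
  LinearMap.id - (LinearMap.mulLeft ℝ β).comp Complex.conjAe.toLinearMap

theorem subMulConj_apply (β w : ℂ) : subMulConj β w = w - β * conj w := rfl

theorem det_subMulConj (β : ℂ) : LinearMap.det (subMulConj β) = 1 - ‖β‖ ^ 2 := by
  rw [← LinearMap.det_toMatrix Complex.basisOneI, Matrix.det_fin_two]
  simp only [LinearMap.toMatrix_apply, subMulConj_apply, Complex.coe_basisOneI,
    Complex.coe_basisOneI_repr, ← Complex.normSq_eq_norm_sq, Complex.normSq_apply]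
  simp
  ring

/-- The right side is the value of the left at `s = ρ`: for small `ρ` the decay of `s⁻¹` outweighs
the growth of the other terms. -/
theorem inv_add_mul_le_of_lt {B C ρ s : ℝ} (hB : 0 ≤ B) (hC : 0 ≤ C) (hρ : 0 < ρ) (hρs : ρ < s)
    (hs : s < 1) (hBρ : 4 * B * ρ ≤ 1) (hCρ : 4 * C * ρ ≤ 1) :
    s⁻¹ + B * s * (1 - ρ ^ 2 / s ^ 2) + C * s ^ 2 ≤ ρ⁻¹ + C * ρ ^ 2 := by
  have hs0 : 0 < s := hρ.trans hρs
  have key : ρ⁻¹ + C * ρ ^ 2 - (s⁻¹ + B * s * (1 - ρ ^ 2 / s ^ 2) + C * s ^ 2) =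
      (s - ρ) / (s * ρ) * (1 - B * ρ * (s + ρ) - C * ρ * (s * (s + ρ))) := by
    field_simp
    ring
  have h1 : B * ρ * (s + ρ) ≤ B * ρ * 2 := by gcongr; linarith
  have h2 : C * ρ * (s * (s + ρ)) ≤ C * ρ * (1 * 2) := by gcongr; linarith
  have h3 : 0 ≤ (s - ρ) / (s * ρ) * (1 - B * ρ * (s + ρ) - C * ρ * (s * (s + ρ))) :=
    mul_nonneg (div_nonneg (by linarith) (by positivity)) (by linarith)
  linarith

/-- On `|z| = ρ` one has `ρ² * conj z⁻¹ = z`, so the correction cancels the term `b * z`.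
Uncorrected, the radius `ρ⁻¹ + |b|ρ` would leave an excess `2|b|` in its square, which does not
vanish with `ρ`. -/
theorem norm_subMulConj_le {b k z : ℂ} {C ρ : ℝ} (hk : ‖k‖ ≤ C) (hρ : 0 < ρ) (hρz : ρ < ‖z‖)
    (hz : ‖z‖ < 1) (hBρ : 4 * ‖b‖ * ρ ≤ 1) (hCρ : 4 * C * ρ ≤ 1) :
    ‖subMulConj (b * (ρ : ℂ) ^ 2) (z⁻¹ + z * (b + z * k))‖ ≤
      ρ⁻¹ + (C + ‖b‖ * (‖b‖ + C)) * ρ ^ 2 := by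
  have hz0 : z ≠ 0 := norm_pos_iff.1 (hρ.trans hρz)
  have hC : 0 ≤ C := (norm_nonneg k).trans hk
  have hs0 : 0 < ‖z‖ := hρ.trans hρz
  have hconj : conj z⁻¹ = z / (‖z‖ : ℂ) ^ 2 := by
    rw [map_inv₀, ← Complex.mul_conj']
    have : conj z ≠ 0 := by simpa using hz0
    field_simp
  have e : subMulConj (b * (ρ : ℂ) ^ 2) (z⁻¹ + z * (b + z * k)) =
      z⁻¹ + b * z * ((1 - ρ ^ 2 / ‖z‖ ^ 2 : ℝ) : ℂ) + k * z ^ 2 -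
        b * (ρ : ℂ) ^ 2 * conj (z * (b + z * k)) := by
    rw [subMulConj_apply, map_add, hconj]
    push_cast
    ring
  have h1 : 0 ≤ 1 - ρ ^ 2 / ‖z‖ ^ 2 := by
    rw [sub_nonneg, div_le_one (by positivity)]; gcongr
  have h2 : ‖z * (b + z * k)‖ ≤ 1 * (‖b‖ + 1 * C) := by
    rw [norm_mul]
    gcongr
    refine (norm_add_le _ _).trans ?_
    rw [norm_mul]
    gcongr
  calc _ ≤ ‖z⁻¹‖ + ‖b * z * ((1 - ρ ^ 2 / ‖z‖ ^ 2 : ℝ) : ℂ)‖ + ‖k * z ^ 2‖ +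
        ‖b * (ρ : ℂ) ^ 2 * conj (z * (b + z * k))‖ := by
        rw [e]
        exact (norm_sub_le _ _).trans (add_le_add_left (norm_add₃_le) _)
    _ ≤ ‖z‖⁻¹ + ‖b‖ * ‖z‖ * (1 - ρ ^ 2 / ‖z‖ ^ 2) + C * ‖z‖ ^ 2 +
        ‖b‖ * ρ ^ 2 * (1 * (‖b‖ + 1 * C)) := by
        simp only [norm_mul, norm_inv, norm_pow, Complex.norm_real, Real.norm_eq_abs,
          abs_of_nonneg h1, abs_of_pos hρ, Complex.norm_conj] at h2 ⊢
        gcongr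
    _ ≤ (ρ⁻¹ + C * ρ ^ 2) + ‖b‖ * ρ ^ 2 * (1 * (‖b‖ + 1 * C)) := by
        linarith [inv_add_mul_le_of_lt (norm_nonneg b) hC hρ hρz hz hBρ hCρ]
    _ = _ := by ring

theorem exists_volume_image_annulus_le {p : ℂ → ℂ} {r : ℝ}
    (hp : DifferentiableOn ℂ p (ball 0 1)) (hr : r < 1) :
    ∃ B K : ℝ, 0 ≤ K ∧ ∀ᶠ ρ in 𝓝[>] (0 : ℝ),
      ENNReal.ofReal (1 - B * ρ ^ 4) *
        volume ((fun z ↦ z⁻¹ + p z) '' {z : ℂ | ρ < ‖z‖ ∧ ‖z‖ < r}) ≤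
      ENNReal.ofReal (π * (ρ⁻¹ + K * ρ ^ 2) ^ 2) := by
  have h0 : ball (0 : ℂ) 1 ∈ 𝓝 0 := ball_mem_nhds _ one_pos
  -- Here `p z = p 0 + z * (q 0 + z * κ z)`; as `r < 1`, `κ` is bounded on the closed disc of radius
  -- `r`.
  set q := dslope p 0
  set κ := dslope q 0
  have hκ : ContinuousOn κ (closedBall 0 r) :=
    (((Complex.differentiableOn_dslope h0).2
      ((Complex.differentiableOn_dslope h0).2 hp)).continuousOn).mono (closedBall_subset_ball hr)
  obtain ⟨C, hC⟩ := (isCompact_closedBall (0 : ℂ) r).exists_bound_of_continuousOn hκ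
  set D := max C 0 with hD
  have hD0 : 0 ≤ D := le_max_right _ _
  refine ⟨‖q 0‖ ^ 2, D + ‖q 0‖ * (‖q 0‖ + D), by positivity, ?_⟩
  have small : ∀ c : ℝ, ∀ᶠ ρ in 𝓝[>] (0 : ℝ), c * ρ ≤ 1 := fun c ↦ by
    have : Tendsto (fun ρ : ℝ ↦ c * ρ) (𝓝[>] 0) (𝓝 0) := by
      have : ContinuousAt (fun ρ : ℝ ↦ c * ρ) 0 := by fun_prop
      simpa using this.tendsto.mono_left nhdsWithin_le_nhds
    exact this.eventually_le_const one_pos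
  filter_upwards [small (4 * ‖q 0‖), small (4 * D), self_mem_nhdsWithin] with ρ h1 h2 hρ
  have hρ : 0 < ρ := hρ
  set A : Set ℂ := {z : ℂ | ρ < ‖z‖ ∧ ‖z‖ < r}
  set L := subMulConj (q 0 * (ρ : ℂ) ^ 2)
  have hsub : L '' ((fun z ↦ z⁻¹ + p z) '' A) ⊆
      closedBall (L (p 0)) (ρ⁻¹ + (D + ‖q 0‖ * (‖q 0‖ + D)) * ρ ^ 2) := by
    rintro _ ⟨_, ⟨z, hz, rfl⟩, rfl⟩
    have e : z⁻¹ + p z - p 0 = z⁻¹ + z * (q 0 + z * κ z) := by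
      rw [eq_add_mul_dslope p z, ← eq_add_mul_dslope q z]; ring
    rw [mem_closedBall, dist_eq_norm, ← map_sub, e]
    exact norm_subMulConj_le ((hC z (by simpa using hz.2.le)).trans (le_max_left _ _)) hρ hz.1
      (hz.2.trans hr) h1 h2
  have hvol := measure_mono (μ := volume) hsub
  rw [Measure.addHaar_image_linearMap, Complex.volume_closedBall, det_subMulConj] at hvol
  calc _ ≤ _ := mul_le_mul_left (ENNReal.ofReal_le_ofReal ((le_abs_self _).trans_eq (by
        simp only [norm_mul, norm_pow, Complex.norm_real, Real.norm_eq_abs, abs_of_pos hρ]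
        ring_nf))) _
    _ ≤ _ := hvol
    _ = _ := by
      rw [← ENNReal.ofReal_pow (by positivity), ENNReal.ofReal_mul' (by positivity), mul_comm]
      congr 1
      rw [← NNReal.coe_real_pi, ENNReal.ofReal_coe_nnreal]

/-- **Gronwall's area theorem**, for the first `N` coefficients. -/
theorem sum_mul_norm_taylorCoeff_sq_le_one {p : ℂ → ℂ} (hp : DifferentiableOn ℂ p (ball 0 1))
    (hinj : InjOn (fun z ↦ z⁻¹ + p z) (ball 0 1 \ {0})) (N : ℕ) :
    ∑ k ∈ Finset.range N, (k + 1) * ‖taylorCoeff p (k + 1)‖ ^ 2 ≤ 1 := by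
  set S : ℝ → ℝ := fun s ↦ ∑ k ∈ Finset.range N,
    (k + 1) * ‖taylorCoeff p (k + 1)‖ ^ 2 * s ^ (2 * k + 2) with hS
  have hSc : Continuous S := by fun_prop
  have hS0 : S 0 = 0 := by simp [hS]
  have hlim : ∀ r : ℝ, 0 < r → r < 1 → S r ≤ (r ^ 2)⁻¹ := by
    intro r hr0 hr
    obtain ⟨B, K, hK, hBK⟩ := exists_volume_image_annulus_le hp hr
    -- The two area bounds after dividing by `π` and cancelling `ρ⁻²`; the term `B * ρ ^ 2` is `B *
    -- ρ ^ 4` times `ρ⁻²`.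
    have hev : ∀ᶠ ρ in 𝓝[>] (0 : ℝ),
        (1 - B * ρ ^ 4) * (S r - (r ^ 2)⁻¹ - S ρ) - B * ρ ^ 2 ≤ 2 * K * ρ + K ^ 2 * ρ ^ 4 := by
      have hB1 : ∀ᶠ ρ in 𝓝[>] (0 : ℝ), 0 < 1 - B * ρ ^ 4 := by
        have : ContinuousAt (fun ρ : ℝ ↦ 1 - B * ρ ^ 4) 0 := by fun_prop
        exact (this.tendsto.mono_left nhdsWithin_le_nhds).eventually_const_lt (by simp)
      filter_upwards [hBK, hB1, Ioo_mem_nhdsGT hr0] with ρ h1 h2 h3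
      have hρ : 0 < ρ := h3.1
      have hsub : {z : ℂ | ρ < ‖z‖ ∧ ‖z‖ < r} ⊆ ball 0 1 \ {0} := fun z hz ↦
        ⟨by simpa using hz.2.trans hr, by simpa using norm_pos_iff.1 (hρ.trans hz.1)⟩
      have hlow := ofReal_le_volume_image_annulus hp hρ h3.2.le hr (hinj.mono hsub) N
      have h4 := (mul_le_mul_right hlow _).trans h1
      rw [← ENNReal.ofReal_mul h2.le, ENNReal.ofReal_le_ofReal_iff (by positivity),
        mul_left_comm, mul_le_mul_iff_right₀ Real.pi_pos] at h4
      have e1 : (1 - B * ρ ^ 4) * ((ρ ^ 2)⁻¹ - (r ^ 2)⁻¹ + (S r - S ρ)) =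
          (1 - B * ρ ^ 4) * (S r - (r ^ 2)⁻¹ - S ρ) - B * ρ ^ 2 + (ρ ^ 2)⁻¹ := by
        field_simp; ring
      have e2 : (ρ⁻¹ + K * ρ ^ 2) ^ 2 = 2 * K * ρ + K ^ 2 * ρ ^ 4 + (ρ ^ 2)⁻¹ := by
        field_simp; ring
      rw [e2] at h4
      linarith [e1 ▸ h4]
    have c1 : ContinuousAt
        (fun ρ : ℝ ↦ (1 - B * ρ ^ 4) * (S r - (r ^ 2)⁻¹ - S ρ) - B * ρ ^ 2) 0 := by fun_prop
    have c2 : ContinuousAt (fun ρ : ℝ ↦ 2 * K * ρ + K ^ 2 * ρ ^ 4) 0 := by fun_prop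
    have := le_of_tendsto_of_tendsto (c1.tendsto.mono_left nhdsWithin_le_nhds)
      (c2.tendsto.mono_left nhdsWithin_le_nhds) hev
    simp only [hS0] at this
    norm_num at this
    exact this
  have c1 : ContinuousAt S 1 := hSc.continuousAt
  have c2 : ContinuousAt (fun r : ℝ ↦ (r ^ 2)⁻¹) 1 :=
    (continuousAt_id.pow 2).inv₀ (by simp)
  have hev : ∀ᶠ r in 𝓝[<] (1 : ℝ), S r ≤ (r ^ 2)⁻¹ := by
    filter_upwards [Ioo_mem_nhdsLT one_pos] with r hr using hlim r hr.1 hr.2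
  have := le_of_tendsto_of_tendsto (c1.tendsto.mono_left nhdsWithin_le_nhds)
    (c2.tendsto.mono_left nhdsWithin_le_nhds) hev
  simpa [hS] using this

end AreaTheorem

/-! ### Coefficients of the reciprocal of a univalent function. -/

section ClassS

open Metric Set Filter Topology

/-- The coefficients `b₁, b₂, …` of the expansion `1 / f z = 1 / z + b₀ + b₁ z + b₂ z ^ 2 + ⋯` of the
reciprocal of a univalent function are those of the reciprocal of `f z / z`, and they satisfy the
area theorem. -/
theorem exists_reciprocal_taylorCoeff {f : ℂ → ℂ} (hf : f ∈ classS) :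
    ∃ c : ℕ → ℂ, c 0 = 1 ∧
      (∀ n, ∑ i ∈ Finset.range (n + 2), taylorCoeff f (i + 1) * c (n + 1 - i) = 0) ∧
      ∀ N, ∑ k ∈ Finset.range N, (k + 1) * ‖c (k + 2)‖ ^ 2 ≤ 1 := by
  obtain ⟨⟨han, hf0, hf1⟩, hinj⟩ := hf
  have h0 : ball (0 : ℂ) 1 ∈ 𝓝 0 := ball_mem_nhds _ one_pos
  set φ := dslope f 0 with hφ
  have hfφ : ∀ z, f z = z * φ z := fun z ↦ by rw [eq_add_mul_dslope f z, hf0, zero_add]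
  have hφd : DifferentiableOn ℂ φ (ball 0 1) :=
    (Complex.differentiableOn_dslope h0).2 han.differentiableOn
  have hφ0 : φ 0 = 1 := by rw [hφ, dslope_same, hf1]
  have hφne : ∀ z ∈ ball (0 : ℂ) 1, φ z ≠ 0 := by
    intro z hz h
    have : z = 0 := hinj hz (mem_of_mem_nhds h0) (by rw [hfφ z, h, mul_zero, hf0])
    simp [this, hφ0] at h
  have hκd : DifferentiableOn ℂ φ⁻¹ (ball 0 1) := hφd.inv hφne
  have hκ0 : φ⁻¹ 0 = 1 := by simp [hφ0]
  have hpd : DifferentiableOn ℂ (dslope φ⁻¹ 0) (ball 0 1) :=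
    (Complex.differentiableOn_dslope h0).2 hκd
  have hrec : ∀ z : ℂ, z ≠ 0 → z⁻¹ + dslope φ⁻¹ 0 z = (f z)⁻¹ := by
    intro z hz
    have h1 := eq_add_mul_dslope φ⁻¹ z
    rw [hκ0, Pi.inv_apply] at h1
    rw [hfφ z, mul_inv, h1]
    field_simp
  have hpinj : InjOn (fun z ↦ z⁻¹ + dslope φ⁻¹ 0 z) (ball 0 1 \ {0}) := by
    intro z hz w hw h
    simp only [hrec z hz.2, hrec w hw.2, inv_inj] at h
    exact hinj hz.1 hw.1 h
  refine ⟨taylorCoeff φ⁻¹, by rw [taylorCoeff_zero, hκ0], fun n ↦ ?_, fun N ↦ ?_⟩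
  · have hmul := taylorCoeff_mul (hφd.analyticAt h0) (hκd.analyticAt h0) (n + 1)
    have hone : φ * φ⁻¹ =ᶠ[𝓝 0] fun _ ↦ 1 := by
      filter_upwards [h0] with z hz using mul_inv_cancel₀ (hφne z hz)
    have hz : taylorCoeff (φ * φ⁻¹) (n + 1) = 0 := by
      rw [taylorCoeff, hone.iteratedDeriv_eq]
      simp [iteratedDeriv_const]
    rw [hz] at hmul
    simp only [hφ, taylorCoeff_dslope (han 0 (mem_of_mem_nhds h0))] at hmul
    exact hmul.symm
  -- Taking `dslope` shifts the index by one, hence `c (k + 2)` where the area theorem has `k + 1`.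
  · simpa only [taylorCoeff_dslope (hκd.analyticAt h0)] using
      sum_mul_norm_taylorCoeff_sq_le_one hpd hpinj N

theorem norm_sq_add_two_mul_norm_sq_add_three_mul_norm_sq_le_one {f : ℂ → ℂ} (hf : f ∈ classS)
    (h3 : taylorCoeff f 3 = 0) :
    (‖taylorCoeff f 2‖ ^ 2) ^ 2 + 2 * ‖taylorCoeff f 4 + taylorCoeff f 2 ^ 3‖ ^ 2 +
      3 * ‖taylorCoeff f 5 - 2 * taylorCoeff f 2 * taylorCoeff f 4 - taylorCoeff f 2 ^ 4‖ ^ 2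
        ≤ 1 := by
  have h1 : taylorCoeff f 1 = 1 := by rw [taylorCoeff_one, hf.1.2.2]
  obtain ⟨c, c0, hc, harea⟩ := exists_reciprocal_taylorCoeff hf
  have e0 := hc 0
  have e1 := hc 1
  have e2 := hc 2
  have e3 := hc 3
  have hA := harea 3
  simp only [Finset.sum_range_succ, Finset.range_zero, Finset.sum_empty, h1, h3, c0, zero_add,
    Nat.reduceAdd, Nat.reduceSub, one_mul, mul_one, zero_mul, add_zero, Nat.sub_zero,
    Nat.sub_self] at e0 e1 e2 e3 hA
  have k1 : c 1 = -taylorCoeff f 2 := by linear_combination e0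
  have k2 : c 2 = taylorCoeff f 2 ^ 2 := by
    rw [k1] at e1; linear_combination e1
  have k3 : c 3 = -(taylorCoeff f 4 + taylorCoeff f 2 ^ 3) := by
    rw [k2] at e2; linear_combination e2
  have k4 : c 4 = -(taylorCoeff f 5 - 2 * taylorCoeff f 2 * taylorCoeff f 4
      - taylorCoeff f 2 ^ 4) := by
    rw [k3, k1] at e3; linear_combination e3
  rw [k2, k3, k4, norm_neg, norm_neg, norm_pow] at hA
  norm_num at hA
  linarith

end ClassS

/-! ### The five estimates. -/

theorem theorem2p2 (f : ℂ → ℂ) (hf : f ∈ classS) (h3 : taylorCoeff f 3 = 0) :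
    ‖taylorCoeff f 2‖ ≤ 1 ∧
    ‖taylorCoeff f 4‖ ≤ (√37 + 13) / 12 ∧
    ‖taylorCoeff f 5‖ ≤ 1 / 4 * √(757 / 15) + 85 / 64 ∧
    ‖hankelTwoTwo f‖ ≤ (13 + √37) / 12 ∧
    ‖hankelThreeOne f‖ ≤ (24 + √645) / 30 := by
  have harea := norm_sq_add_two_mul_norm_sq_add_three_mul_norm_sq_le_one hf h3
  simp only [hankelTwoTwo, hankelThreeOne, h3]
  set a := taylorCoeff f 2
  set b := taylorCoeff f 4
  set d := taylorCoeff f 5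
  set u := b + a ^ 3 with hu
  set v := d - 2 * a * b - a ^ 4 with hv
  have hx0 := norm_nonneg a
  have hy0 := norm_nonneg u
  have hz0 := norm_nonneg v
  have hb : b = u - a ^ 3 := by rw [hu]; ring
  have hd : d = v + 2 * a * u - a ^ 4 := by rw [hv, hu]; ring
  have hx : ‖a‖ ≤ 1 := by
    have : (‖a‖ ^ 2) ^ 2 ≤ 1 := by nlinarith [sq_nonneg ‖u‖, sq_nonneg ‖v‖]
    by_contra! h
    nlinarith [one_lt_pow₀ h (n := 4) (by norm_num)]
  have hx4 : 0 ≤ (‖a‖ ^ 2) ^ 2 := by positivity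
  -- With these, the rational bounds 19/12, 3 and 7/6 below are enough.
  have h37 : (6 : ℝ) ≤ √37 := Real.le_sqrt_of_sq_le (by norm_num)
  have h757 : (7 : ℝ) ≤ √(757 / 15) := Real.le_sqrt_of_sq_le (by norm_num)
  have h645 : (25 : ℝ) ≤ √645 := Real.le_sqrt_of_sq_le (by norm_num)
  have hb4 : ‖b‖ ≤ 19 / 12 := by
    have h1 : ‖b‖ ≤ ‖u‖ + ‖a‖ ^ 3 := by
      rw [hb]; exact (norm_sub_le _ _).trans_eq (by rw [norm_pow])
    have h2 : ‖a‖ ^ 3 ≤ ‖a‖ ^ 2 := pow_le_pow_of_le_one hx0 hx (by norm_num)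
    -- The points 4/5 and 1/2 are close to the maximiser of `X + y` on `X² + 2y² ≤ 1`, where `X =
    -- ‖a‖ ^ 2` and `y = ‖u‖`.
    nlinarith [sq_nonneg (‖a‖ ^ 2 - 4 / 5), sq_nonneg (‖u‖ - 1 / 2), sq_nonneg ‖v‖]
  have hd5 : ‖d‖ ≤ 3 := by
    have h1 : ‖d‖ ≤ ‖v‖ + 2 * ‖a‖ * ‖u‖ + ‖a‖ ^ 4 := by
      rw [hd]
      refine (norm_sub_le _ _).trans ?_
      rw [norm_pow]
      gcongr
      refine (norm_add_le _ _).trans_eq ?_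
      simp
    have h2 : ‖a‖ * ‖u‖ ≤ 1 * ‖u‖ := by gcongr
    nlinarith [sq_nonneg (‖u‖ - 1 / 2), sq_nonneg (3 * ‖v‖ - 1)]
  have hH : ‖u ^ 2 + a ^ 2 * v‖ ≤ 7 / 6 := by
    have h1 : ‖u ^ 2 + a ^ 2 * v‖ ≤ ‖u‖ ^ 2 + ‖a‖ ^ 2 * ‖v‖ := by
      refine (norm_add_le _ _).trans_eq ?_
      simp
    -- By AM-GM, `‖a‖²‖v‖ ≤ (‖a‖⁴ + ‖v‖²)/2`, which `harea` controls.
    nlinarith [sq_nonneg (‖a‖ ^ 2 - ‖v‖), sq_nonneg ‖v‖]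
  refine ⟨hx, by linarith, by linarith, ?_, ?_⟩
  · have : ‖a * b - 0 ^ 2‖ ≤ 1 * ‖b‖ := by
      simp only [ne_eq, OfNat.ofNat_ne_zero, not_false_eq_true, zero_pow, sub_zero, norm_mul]
      gcongr
    exact this.trans (by linarith)
  · have e : 0 * (a * b - 0 ^ 2) - b * (b - a * 0) + d * (0 - a ^ 2) = -(u ^ 2 + a ^ 2 * v) := by
      rw [hv, hu]; ring
    rw [e, norm_neg]
    linarith
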